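/- Let $\nu,s\ge 1$, $n,t\ge 0$ and $0\le k\le n$ be integers, and let $\mathbf t=(t_1,\dots,t_s)$ be integers $t_i\ge 0$ with $t_1+\cdots+t_s=t$. The generalized Ward numbers $W^{(\nu)}(n,k;s,t)$ are defined by $$W^{(\nu)}(n,k;s,t)=(k+s)\,W^{(\nu)}(n-1,k;s,t)+(\nu n+k+s+t-1-\nu)\,W^{(\nu)}(n-1,k-1;s,t)+\delta_{k0}\delta_{n0},$$ with $W^{(\nu)}(n,k;s,t)=0$ if $n<0$ or $k<0$. For a finite set $X$ of positive integers, a $(d,u)$-ary increasing $X$-tree is a rooted tree whose internal nodes are labelled bijectively by $\{0\}\cup X$ with labels increasing along every path away from the root, in which the root $0$ has $u$ ordered positions for children and every other internal node has $d$; each position is occupied by an internal node or by an unlabelled external node. A $(\nu+2,\mathbf t+\mathbf 1)$-ary increasing $(s,[n])$-forest is a sequence $\mathbf F=(T_1,\dots,T_s)$ such that, for some ordered partition $(X_1,\dots,X_s)$ of $[n]=\{1,\dots,n\}$ into possibly empty parts, each $T_i$ is a $(\nu+2,t_i+1)$-ary increasing $X_i$-tree. The word of a tree is empty for an external node, and it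 is $w_1\,a\,w_2\,a\cdots a\,w_d$ for a root labelled $a$ whose subtrees, in order, have words $w_1,\dots,w_d$. The number of ascents of $\mathbf F$ is the sum over $i$ of the number of ascents (positions $j$ with $r_j<r_{j+1}$) of the word $r_1r_2\cdots$ of $T_i$. For a tree $T$, let $\mathcal E(T)$ be the set of internal nodes of $T$ that are the first (leftmost) children of their parents. If $t_i>0$, put $\mathcal D_{t_i}(T_i)=\mathcal E(T_i)$. If $t_i=0$, let $T_i'$ be the (possibly empty) subtree in the unique position below the root $0$; then $\mathcal D_0(T_i)$ consists of $\mathcal E(T_i')$ together with the root of $T_i'$ when $T_i'$ is not empty. Put $\mathcal D_{\mathbf t}(\mathbf F)=\bigcup_{i=1}^s\mathcal D_{t_i}(T_i)$. Then $W^{(\nu)}(n,k;s,t)$ is the number of pairs $(\mathbf F,S)$ in which $\mathbf F$ is a $(\nu+2,\mathbf t+\mathbf 1)$-ary increasing $(s,[n])$-forest with at most $k$ ascents and $S\subseteq\mathcal D_{\mathbf t}(\mathbf F)$ is a set of exactly $n-k$ (distinguished) nodes. -/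

import Mathlib

/-- The `ν`-order generalized `(s,t)`-Ward numbers `W^{(ν)}(n,k;s,t)`, with the boundary cases
of the recurrence (all terms with `n < 0` or `k < 0` vanish) written out; see
`wardNumber_recurrence` for the recurrence in its usual form. -/
def wardNumber (ν s t : ℕ) : ℕ → ℕ → ℕ
  | 0, 0 => 1
  | 0, _ + 1 => 0
  | n + 1, 0 => s * wardNumber ν s t n 0
  | n + 1, k + 1 =>
      (k + 1 + s) * wardNumber ν s t n (k + 1) + (ν * n + k + s + t) * wardNumber ν s t n k

/-- The Ward numbers with arbitrary integer indices, zero if `n < 0` or `k < 0`. -/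
def wardNumberInt (ν s t : ℕ) (n k : ℤ) : ℤ :=
  if 0 ≤ n ∧ 0 ≤ k then (wardNumber ν s t n.toNat k.toNat : ℤ) else 0

/-- The defining recurrence of the Ward numbers. -/
theorem wardNumber_recurrence (ν s t : ℕ) (n k : ℤ) (hn : 0 ≤ n) (hk : 0 ≤ k) :
    wardNumberInt ν s t n k =
      (k + s) * wardNumberInt ν s t (n - 1) k
        + (ν * n + k + s + t - 1 - ν) * wardNumberInt ν s t (n - 1) (k - 1)
        + (if k = 0 then 1 else 0) * (if n = 0 then 1 else 0) := by
  obtain ⟨n, rfl⟩ := Int.eq_ofNat_of_zero_le hn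
  obtain ⟨k, rfl⟩ := Int.eq_ofNat_of_zero_le hk
  have h : ∀ m : ℕ, ((m : ℤ) + 1).toNat = m + 1 := fun m => by omega
  have h0 : ∀ m : ℕ, ((m : ℤ) + 1 = 0) ↔ False :=
    fun m => iff_false_intro (by omega)
  have h1 : ∀ m : ℕ, (0 : ℤ) ≤ (m : ℤ) + 1 := fun m => by omega
  rcases n with _ | n <;> rcases k with _ | k <;>
    simp [wardNumberInt, wardNumber, h, h0, h1]
  left
  ring

/-- Rooted plane trees: `ext` is an external node (drawn `∅`), and `node a d c` is an internal
node with label `a` and `d` labelled (ordered) positions for children, the subtree in position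
`i` being `c i`. -/
inductive PlaneTree : Type
  | ext : PlaneTree
  | node (a d : ℕ) (c : Fin d → PlaneTree) : PlaneTree

namespace PlaneTree

/-- The multiset of the labels of the internal nodes. -/
def labels : PlaneTree → Multiset ℕ
  | ext => 0
  | node a _ c => a ::ₘ ∑ i, labels (c i)

/-- Labels increase strictly along each path that leads away from the root. -/
def IsIncreasing : PlaneTree → Prop
  | ext => True
  | node a _ c => ∀ i, (∀ b ∈ labels (c i), a < b) ∧ IsIncreasing (c i)

/-- Each internal node with label `a` has exactly `f a` positions for children. -/
def HasArity (f : ℕ → ℕ) : PlaneTree → Prop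
  | ext => True
  | node a d c => d = f a ∧ ∀ i, HasArity f (c i)

/-- The word of a tree: the word of a node labelled `a` with subtrees `T₁, …, T_d` is
`w₁ a w₂ a ⋯ a w_d`, where `wᵢ` is the word of `Tᵢ`. -/
def word : PlaneTree → List ℕ
  | ext => []
  | node a _ c => List.intercalate [a] (List.ofFn fun i => word (c i))

/-- The root, if it is an internal node (as a set of at most one label). -/
def rootSet : PlaneTree → Finset ℕ
  | ext => ∅
  | node a _ _ => {a}

/-- The subtree in the first (leftmost) position of the root. -/
def firstSubtree : PlaneTree → PlaneTree
  | ext => ext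
  | node _ 0 _ => ext
  | node _ (_ + 1) c => c 0

/-- `ℰ(T)`: the internal nodes (given by their labels) that are the first children of their
parents. -/
def firstChildren : PlaneTree → Finset ℕ
  | ext => ∅
  | node a d c => rootSet (firstSubtree (node a d c)) ∪
      Finset.univ.biUnion fun i => firstChildren (c i)

/-- `T` is a `(d,u)`-ary increasing `X`-tree: its internal nodes are labelled bijectively by
`{0} ∪ X`, labels increase away from the root (so that the root is `0`), the root `0` has `u`
positions for children and every other internal node has `d`. -/
def IsAryIncreasing (d u : ℕ) (X : Finset ℕ) (T : PlaneTree) : Prop :=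
  T.labels = (insert 0 X).val ∧ T.IsIncreasing ∧ T.HasArity fun a => if a = 0 then u else d

/-- The set `𝒟_t(T)` of a `(d,t+1)`-ary increasing tree `T`. For `t > 0` it is `ℰ(T)`.
For `t = 0` the root `0` has a single position, and `T` is identified with the (possibly empty)
`d`-ary increasing tree `T'` in that position; the set then consists of the root of `T'`, if `T'`
is not empty, and of `ℰ(T')`. -/
def distinguishable (t : ℕ) (T : PlaneTree) : Finset ℕ :=
  if t = 0 then T.firstSubtree.rootSet ∪ T.firstSubtree.firstChildren
  else T.firstChildren

end PlaneTree

/-- The number of ascents of a word `r₁ r₂ ⋯ r_m`: the number of `i < m` with `rᵢ < rᵢ₊₁`. -/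
def ascents (w : List ℕ) : ℕ :=
  (w.zip w.tail).countP fun p => p.1 < p.2

/-- `F = (T₁, …, T_s)` is a `(d,u)`-ary increasing `(s,[n])`-forest: for some ordered partition
`(X₁, …, X_s)` of `{1, …, n}` into possibly empty parts, `Tᵢ` is a `(d,uᵢ)`-ary increasing
`Xᵢ`-tree. -/
def IsAryIncreasingForest {s : ℕ} (d : ℕ) (u : Fin s → ℕ) (n : ℕ) (F : Fin s → PlaneTree) :
    Prop :=
  ∃ X : Fin s → Finset ℕ,
    (∀ i j, i ≠ j → Disjoint (X i) (X j)) ∧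
    Finset.univ.biUnion X = Finset.Icc 1 n ∧
    ∀ i, (F i).IsAryIncreasing d (u i) (X i)

/-- The number of ascents of a forest: the total number of ascents of the words of its
components (the entries of the corresponding generalized Stirling permutation). -/
def forestAscents {s : ℕ} (F : Fin s → PlaneTree) : ℕ :=
  ∑ i, ascents (F i).word

/-- `𝒟_𝐭(F)`, the union of the sets `𝒟_{tᵢ}(Tᵢ)` over the components of `F`. -/
def forestDistinguishable {s : ℕ} (t : Fin s → ℕ) (F : Fin s → PlaneTree) : Finset ℕ :=
  Finset.univ.biUnion fun i => (F i).distinguishable (t i)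

/-! ### Ascents of words -/

/-! The bound on ascents turns out to be automatic, and what remains is a count that satisfies the
Ward recurrence.

In the word `w₁ a w₂ a ⋯ a w_d` all letters of the `wᵢ` exceed `a`, so stepping from a block to `a`
is never an ascent, and stepping from `a` into a nonempty block `wᵢ` with `i ≥ 2` costs at most one.
Ascents can thus be charged injectively to nodes that are neither roots nor first children, and a
forest on `[n]` satisfies `ascents + D ≤ n`, where `D` is its number of first children
(`IsAryIncreasingForest.ascents_add_le`). If `n - k` first children are marked, then `D ≥ n - k` and
there are at most `k` ascents. As `𝒟_𝐭(F)` is just the set of first children, also when some `tᵢ =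
0`, the pairs number `M(n, r) = ∑_F C(D(F), r)` with `r = n - k`.

The largest label `n + 1` always sits on a leaf, so a forest on `[n+1]` is a forest on `[n]` with a
chosen external node (`graftForestEquiv`). There are `t + s + (ν+1)n` external nodes. Exactly `n + s
- D` of them are in first positions, and only these raise `D` by one. Pascal's rule together with `D
C(D,r) = r C(D,r) + (r+1) C(D,r+1)` gives `M(n+1, r+1) = (n + s - r) M(n, r) + (t + s + (ν+1)n - r -
1) M(n, r+1)`, which is the Ward recurrence after `r = n - k` is substituted. -/

theorem ascents_cons_cons (a b : ℕ) (w : List ℕ) :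
    ascents (a :: b :: w) = (if a < b then 1 else 0) + ascents (b :: w) := by
  simp only [ascents, List.tail_cons, List.zip_cons_cons, List.countP_cons, decide_eq_true_eq]
  omega

/-- The junction into `a` is not an ascent, because every letter before it is at least `a`. -/
theorem ascents_append_cons_le {a : ℕ} (u : List ℕ) :
    ∀ p : List ℕ, (∀ b ∈ p, a ≤ b) → ascents (p ++ a :: u) ≤ ascents p + ascents (a :: u)
  | [], _ => by simp
  | [b], h => by
      have hb : ¬ b < a := not_lt.mpr (h b (by simp))
      simp [ascents_cons_cons, hb]
  | b :: c :: p, h => by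
      have ih := ascents_append_cons_le u (c :: p) fun x hx => h x (List.mem_cons_of_mem _ hx)
      simp only [List.cons_append, ascents_cons_cons] at ih ⊢
      omega

theorem ascents_cons_le (a : ℕ) (w : List ℕ) :
    ascents (a :: w) ≤ ascents w + if w = [] then 0 else 1 := by
  cases w with
  | nil => simp [ascents]
  | cons b w =>
    rw [ascents_cons_cons]
    split_ifs <;> simp_all [add_comm]

theorem intercalate_singleton_cons_cons (a : ℕ) (v w : List ℕ) (L : List (List ℕ)) :
    List.intercalate [a] (v :: w :: L) = v ++ a :: List.intercalate [a] (w :: L) := by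
  simp [List.intercalate]

theorem ascents_cons_intercalate_le {a : ℕ} (L : List (List ℕ)) :
    ∀ w : List ℕ, (∀ b ∈ w, a ≤ b) → (∀ v ∈ L, ∀ b ∈ v, a ≤ b) →
      ascents (a :: List.intercalate [a] (w :: L)) ≤
        ((w :: L).map fun v => ascents v + if v = [] then 0 else 1).sum := by
  induction L with
  | nil =>
    intro w _ _
    simpa [List.intercalate] using ascents_cons_le a w
  | cons v L ih =>
    intro w hw hL
    have h1 := ih v (hL v (by simp)) fun x hx => hL x (List.mem_cons_of_mem _ hx)
    have h2 := ascents_append_cons_le (a := a) (List.intercalate [a] (v :: L)) (a :: w)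
      (by simpa using hw)
    have h3 := ascents_cons_le a w
    rw [intercalate_singleton_cons_cons, List.map_cons, List.sum_cons]
    rw [List.cons_append] at h2
    omega

/-- The first block is not preceded by `a`, so it is spared the extra ascent that each later
nonempty block may cost. This is why first children enter the count. -/
theorem ascents_intercalate_le {a : ℕ} (L : List (List ℕ)) (w : List ℕ)
    (hw : ∀ b ∈ w, a ≤ b) (hL : ∀ v ∈ L, ∀ b ∈ v, a ≤ b) :
    ascents (List.intercalate [a] (w :: L)) ≤
      ascents w + (L.map fun v => ascents v + if v = [] then 0 else 1).sum := by
  cases L with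
  | nil => simp [List.intercalate]
  | cons v L =>
    rw [intercalate_singleton_cons_cons]
    exact (ascents_append_cons_le _ w hw).trans <| Nat.add_le_add_left
      (ascents_cons_intercalate_le L v (hL v (by simp))
        fun x hx => hL x (List.mem_cons_of_mem _ hx)) _

/-! ### First children, and their trade-off with ascents -/

namespace PlaneTree

/-- The number of first children in `T`, the root being counted as well if `b` holds. -/
def firstCount : Bool → PlaneTree → ℕ
  | _, ext => 0
  | b, node _ _ c => b.toNat + ∑ i, firstCount (decide (i.val = 0)) (c i)

/-- The first children in `T`, together with the root if `b` holds. -/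
def firstSet (b : Bool) (T : PlaneTree) : Finset ℕ :=
  (if b then T.rootSet else ∅) ∪ T.firstChildren

/-- The flag passes the position of a subtree down to its root, which makes the set accessible to
structural induction. -/
theorem firstChildren_node (a d : ℕ) (c : Fin d → PlaneTree) :
    (node a d c).firstChildren = Finset.univ.biUnion fun i => firstSet (decide (i.val = 0)) (c i) := by
  cases d with
  | zero => simp [firstChildren, firstSubtree, rootSet]
  | succ d =>
    ext x
    simp only [firstChildren, firstSubtree, firstSet, Finset.mem_union, Finset.mem_biUnion,
      Finset.mem_univ, true_and]
    constructor
    · rintro (h | ⟨i, h⟩)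
      · exact ⟨0, Or.inl (by simpa using h)⟩
      · exact ⟨i, Or.inr h⟩
    · rintro ⟨i, h | h⟩
      · by_cases hi : i = 0
        · subst hi
          exact Or.inl (by simpa using h)
        · have : i.val ≠ 0 := fun h => hi (Fin.ext h)
          simp [this] at h
      · exact Or.inr ⟨i, h⟩

theorem mem_labels_node {x a d : ℕ} {c : Fin d → PlaneTree} :
    x ∈ (node a d c).labels ↔ x = a ∨ ∃ i, x ∈ (c i).labels := by
  simp [labels, Multiset.mem_sum]

theorem firstSet_subset_labels (T : PlaneTree) :
    ∀ (b : Bool), ∀ x ∈ firstSet b T, x ∈ T.labels := by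
  induction T with
  | ext => intro b x hx; cases b <;> simp [firstSet, rootSet, firstChildren] at hx
  | node a d c ih =>
    intro b x hx
    rw [firstSet, firstChildren_node, Finset.mem_union] at hx
    rw [mem_labels_node]
    rcases hx with hx | hx
    · cases b <;> simp [rootSet] at hx
      exact Or.inl hx
    · obtain ⟨i, -, hi⟩ := Finset.mem_biUnion.mp hx
      exact Or.inr ⟨i, ih i _ x hi⟩

theorem disjoint_labels_of_nodup_sum {ι : Type*} [Fintype ι] {f : ι → Multiset ℕ}
    (h : (∑ i, f i).Nodup) {i j : ι} (hij : i ≠ j) : Disjoint (f i) (f j) := by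
  classical
  have : f i + f j ≤ ∑ i, f i := by
    rw [← Finset.sum_pair hij]
    exact Finset.sum_le_sum_of_subset (Finset.subset_univ _)
  exact (Multiset.nodup_add.mp (Multiset.nodup_of_le this h)).2.2

theorem nodup_of_nodup_sum {ι : Type*} [Fintype ι] {f : ι → Multiset ℕ}
    (h : (∑ i, f i).Nodup) (i : ι) : (f i).Nodup :=
  Multiset.nodup_of_le (Finset.single_le_sum (fun _ _ => zero_le) (Finset.mem_univ i)) h

/-- Nodes are represented by labels in `firstSet` but counted one by one in `firstCount`; distinct
labels reconcile the two. -/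
theorem card_firstSet (T : PlaneTree) :
    T.labels.Nodup → ∀ b : Bool, (firstSet b T).card = firstCount b T := by
  induction T with
  | ext => intro _ b; cases b <;> simp [firstSet, rootSet, firstChildren, firstCount]
  | node a d c ih =>
    intro h b
    rw [labels, Multiset.nodup_cons] at h
    have hc : (firstChildren (node a d c)).card =
        ∑ i, firstCount (decide (i.val = 0)) (c i) := by
      rw [firstChildren_node, Finset.card_biUnion]
      · exact Finset.sum_congr rfl fun i _ => ih i (nodup_of_nodup_sum h.2 i) _
      · intro i _ j _ hij
        rw [Function.onFun, Finset.disjoint_left]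
        intro x hx hy
        exact Multiset.disjoint_left.mp (disjoint_labels_of_nodup_sum h.2 hij)
          (firstSet_subset_labels _ _ x hx) (firstSet_subset_labels _ _ x hy)
    rw [firstCount, ← hc, firstSet]
    cases b with
    | false => simp
    | true =>
      have ha : a ∉ firstChildren (node a d c) := by
        rw [firstChildren_node]
        intro hx
        obtain ⟨i, -, hi⟩ := Finset.mem_biUnion.mp hx
        exact h.1 (Multiset.mem_sum.mpr ⟨i, Finset.mem_univ _, firstSet_subset_labels _ _ a hi⟩)
      rw [Finset.card_union_of_disjoint (by simpa [rootSet] using ha)]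
      simp [rootSet]

theorem card_firstChildren {T : PlaneTree} (h : T.labels.Nodup) :
    T.firstChildren.card = firstCount false T := by
  rw [← card_firstSet T h]
  simp [firstSet]

theorem mem_labels_of_mem_word (T : PlaneTree) : ∀ x ∈ T.word, x ∈ T.labels := by
  induction T with
  | ext => simp [word]
  | node a d c ih =>
    have key : ∀ L : List (List ℕ), ∀ x ∈ List.intercalate [a] L, x = a ∨ ∃ w ∈ L, x ∈ w := by
      intro L
      induction L with
      | nil => simp [List.intercalate]
      | cons v L ihL =>
        intro x hx
        cases L with
        | nil => exact Or.inr ⟨v, by simp, by simpa [List.intercalate] using hx⟩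
        | cons w L =>
          rw [intercalate_singleton_cons_cons, List.mem_append, List.mem_cons] at hx
          rcases hx with hx | hx | hx
          · exact Or.inr ⟨v, by simp, hx⟩
          · exact Or.inl hx
          · rcases ihL x hx with h | ⟨u, hu, h⟩
            · exact Or.inl h
            · exact Or.inr ⟨u, List.mem_cons_of_mem _ hu, h⟩
    intro x hx
    rw [mem_labels_node]
    rcases key _ x hx with h | ⟨w, hw, h⟩
    · exact Or.inl h
    · obtain ⟨i, rfl⟩ := (List.mem_ofFn' _ _).mp hw
      exact Or.inr ⟨i, ih i x h⟩

/-- A nonempty word forces an internal root, which the flag adds to the count. The converse fails: a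
node with at most one position may have an empty word. -/
theorem firstCount_false_add_le (T : PlaneTree) :
    firstCount false T + (if T.word = [] then 0 else 1) ≤ firstCount true T := by
  cases T with
  | ext => simp [word, firstCount]
  | node a d c =>
    simp only [firstCount, Bool.toNat_true, Bool.toNat_false]
    split_ifs <;> omega

/-- Every node is the root, a first child, or some other child; each ascent is charged to a node of
the last kind. -/
theorem ascents_word_add_firstCount_le (T : PlaneTree) :
    T.IsIncreasing → ascents T.word + firstCount true T ≤ T.labels.card := by
  induction T with
  | ext => simp [word, firstCount, ascents]
  | node a d c ih =>
    intro h
    rw [firstCount, labels, Multiset.card_cons, Multiset.card_sum, word, Bool.toNat_true]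
    cases d with
    | zero => simp [List.intercalate, ascents]
    | succ d =>
      have hw : ∀ i, ∀ b ∈ (c i).word, a ≤ b := fun i b hb =>
        ((h i).1 b (mem_labels_of_mem_word _ b hb)).le
      rw [List.ofFn_succ, Fin.sum_univ_succ, Fin.sum_univ_succ (fun i => (c i).labels.card)]
      have h1 := ascents_intercalate_le (a := a) (List.ofFn fun i : Fin d => (c i.succ).word)
        (c 0).word (hw 0) (by
          intro v hv
          obtain ⟨i, rfl⟩ := (List.mem_ofFn' _ _).mp hv
          exact hw _)
      rw [List.map_ofFn, List.sum_ofFn] at h1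
      have h0 := ih 0 (h 0).2
      have h2 : ∑ i : Fin d, (ascents (c i.succ).word + if (c i.succ).word = [] then 0 else 1) +
          ∑ i : Fin d, firstCount false (c i.succ) ≤ ∑ i : Fin d, (c i.succ).labels.card := by
        rw [← Finset.sum_add_distrib]
        refine Finset.sum_le_sum fun i _ => ?_
        have := ih i.succ (h i.succ).2
        have := firstCount_false_add_le (c i.succ)
        omega
      simp only [Function.comp_def, Fin.val_zero, decide_true, Fin.val_succ, Nat.add_eq_zero_iff,
        one_ne_zero, and_false, decide_false] at h1 ⊢
      omega

end PlaneTree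

namespace PlaneTree

/-! ### Grafting and pruning of leaves -/

/-- The positions of the external nodes of a tree. -/
def Slot : PlaneTree → Type
  | ext => Unit
  | node _ _ c => Σ i, Slot (c i)

/-- The external nodes of a tree form a finite type. -/
noncomputable instance Slot.instFintype : (T : PlaneTree) → Fintype T.Slot
  | ext => inferInstanceAs (Fintype Unit)
  | node _ _ c =>
      have : ∀ i, Fintype (c i).Slot := fun i => Slot.instFintype (c i)
      inferInstanceAs (Fintype (Σ i, (c i).Slot))

theorem sum_slot_ext (f : ext.Slot → ℕ) : ∑ σ, f σ = f () :=
  Fintype.sum_unique (ι := Unit) f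

theorem sum_slot_node {a d : ℕ} {c : Fin d → PlaneTree} (f : (node a d c).Slot → ℕ) :
    ∑ σ, f σ = ∑ i, ∑ σ : (c i).Slot, f ⟨i, σ⟩ :=
  Fintype.sum_sigma (α := fun i => (c i).Slot) f

/-- Replace an external node by the tree `X`. -/
def graft (X : PlaneTree) : (T : PlaneTree) → T.Slot → PlaneTree
  | ext, _ => X
  | node a d c, ⟨i, σ⟩ => node a d (Function.update c i (graft X (c i) σ))

/-- The value `1` if an external node is in a first position, and `0` otherwise; `b` tells whether
the root is considered to be in a first position. -/
def slotWeight : Bool → (T : PlaneTree) → T.Slot → ℕ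
  | b, ext, _ => b.toNat
  | _, node _ _ c, ⟨i, σ⟩ => slotWeight (decide (i.val = 0)) (c i) σ

/-- Replace every internal node labelled `m` (with all that is below it) by an external node. -/
def prune (m : ℕ) : PlaneTree → PlaneTree
  | ext => ext
  | node a d c => if a = m then ext else node a d fun i => prune m (c i)

/-- The tree with a single internal node. -/
def leaf (m d : ℕ) : PlaneTree := node m d fun _ => ext

theorem slotWeight_le_one (T : PlaneTree) : ∀ (b : Bool) (σ : T.Slot), slotWeight b T σ ≤ 1 := by
  induction T with
  | ext => intro b σ; exact Bool.toNat_le b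
  | node a d c ih =>
    rintro b ⟨i, σ⟩
    exact ih i _ σ

theorem labels_leaf (m d : ℕ) : (leaf m d).labels = {m} := by
  simp [leaf, labels]

/-- Grafting alters one subtree, so any additive statistic changes by the local increment `y`. It
serves both label multisets and numerical counts. -/
theorem sum_apply_update {ι M : Type*} [Fintype ι] [DecidableEq ι] [AddCommMonoid M]
    (g : ι → PlaneTree → M) (c : ι → PlaneTree) (i : ι) (x : PlaneTree) {y : M}
    (h : g i x = y + g i (c i)) : ∑ j, g j (Function.update c i x j) = y + ∑ j, g j (c j) := by
  rw [← Finset.add_sum_erase _ _ (Finset.mem_univ i),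
    ← Finset.add_sum_erase (a := i) _ (fun j => g j (c j)) (Finset.mem_univ i), ← add_assoc,
    Function.update_self, h]
  congr 1
  refine Finset.sum_congr rfl fun j hj => ?_
  rw [Function.update_of_ne (Finset.ne_of_mem_erase hj)]

theorem labels_graft (X : PlaneTree) (T : PlaneTree) (σ : T.Slot) :
    (graft X T σ).labels = X.labels + T.labels := by
  induction T with
  | ext => simp [graft, labels]
  | node a d c ih =>
    obtain ⟨i, σ⟩ := σ
    rw [graft, labels, sum_apply_update (fun _ => labels) c i _ (ih i σ), labels,
      Multiset.add_cons]

theorem firstCount_graft (m d : ℕ) (T : PlaneTree) :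
    ∀ (b : Bool) (σ : T.Slot),
      firstCount b (graft (leaf m d) T σ) = slotWeight b T σ + firstCount b T := by
  induction T with
  | ext => intro b σ; simp [graft, leaf, firstCount, slotWeight]
  | node a d c ih =>
    rintro b ⟨i, σ⟩
    rw [graft, firstCount, sum_apply_update (fun i => firstCount (decide (i.val = 0))) c i _
      (ih i _ σ), firstCount, slotWeight]
    omega

theorem IsIncreasing.graft {X T : PlaneTree} (hX : X.IsIncreasing)
    (hlt : ∀ a ∈ T.labels, ∀ b ∈ X.labels, a < b) (hT : T.IsIncreasing) (σ : T.Slot) :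
    (graft X T σ).IsIncreasing := by
  induction T with
  | ext => exact hX
  | node a d c ih =>
    obtain ⟨i, σ⟩ := σ
    intro j
    by_cases hj : j = i
    · subst hj
      rw [Function.update_self]
      refine ⟨fun b hb => ?_, ih j (fun x hx => hlt x (mem_labels_node.mpr (Or.inr ⟨j, hx⟩)))
        (hT j).2 σ⟩
      rw [labels_graft, Multiset.mem_add] at hb
      exact hb.elim (hlt a (mem_labels_node.mpr (Or.inl rfl)) b) ((hT j).1 b)
    · rw [Function.update_of_ne hj]
      exact hT j

theorem HasArity.graft {f : ℕ → ℕ} {X T : PlaneTree} (hX : X.HasArity f)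
    (hT : T.HasArity f) (σ : T.Slot) : (graft X T σ).HasArity f := by
  induction T with
  | ext => exact hX
  | node a d c ih =>
    obtain ⟨i, σ⟩ := σ
    refine ⟨hT.1, fun j => ?_⟩
    by_cases hj : j = i
    · subst hj
      rw [Function.update_self]
      exact ih j (hT.2 j) σ
    · rw [Function.update_of_ne hj]
      exact hT.2 j

theorem prune_eq_self {m : ℕ} {T : PlaneTree} (h : m ∉ T.labels) : prune m T = T := by
  induction T with
  | ext => rfl
  | node a d c ih =>
    rw [mem_labels_node, not_or, not_exists] at h
    rw [prune, if_neg (Ne.symm h.1)]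
    congr
    funext i
    exact ih i (h.2 i)

theorem prune_graft {m d : ℕ} {T : PlaneTree} (h : m ∉ T.labels) (σ : T.Slot) :
    prune m (graft (leaf m d) T σ) = T := by
  induction T with
  | ext => simp [graft, leaf, prune]
  | node a e c ih =>
    obtain ⟨i, σ⟩ := σ
    rw [mem_labels_node, not_or, not_exists] at h
    rw [graft, prune, if_neg (Ne.symm h.1)]
    congr
    funext j
    by_cases hj : j = i
    · subst hj
      rw [Function.update_self]
      exact ih j (h.2 j) σ
    · rw [Function.update_of_ne hj]
      exact prune_eq_self (h.2 j)

theorem graft_ne_self {m : ℕ} {X T : PlaneTree} (hX : m ∈ X.labels) (hm : m ∉ T.labels)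
    (σ : T.Slot) : graft X T σ ≠ T := by
  intro h
  apply hm
  rw [← h, labels_graft]
  exact Multiset.mem_add.mpr (Or.inl hX)

theorem graft_injective {m : ℕ} {X T : PlaneTree} (hX : m ∈ X.labels) (hm : m ∉ T.labels) :
    Function.Injective (graft X T) := by
  induction T with
  | ext => exact fun _ _ _ => rfl
  | node a d c ih =>
    rw [mem_labels_node, not_or, not_exists] at hm
    rintro ⟨i, σ⟩ ⟨j, τ⟩ h
    simp only [graft, node.injEq, heq_eq_eq, true_and] at h
    have hij : i = j := by
      by_contra hij
      have := congrFun h i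
      rw [Function.update_self, Function.update_of_ne hij] at this
      exact graft_ne_self hX (hm.2 i) σ this
    subst hij
    have := congrFun h i
    rw [Function.update_self, Function.update_self] at this
    rw [ih i (hm.2 i) this]

theorem eq_ext_of_labels_eq_zero {T : PlaneTree} (h : T.labels = 0) : T = ext := by
  cases T with
  | ext => rfl
  | node a d c => simp [labels] at h

theorem IsIncreasing.prune {T : PlaneTree} (m : ℕ) (h : T.IsIncreasing) :
    (prune m T).IsIncreasing ∧ (prune m T).labels ≤ T.labels := by
  induction T with
  | ext => exact ⟨h, le_rfl⟩
  | node a d c ih =>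
    rw [PlaneTree.prune]
    split_ifs with ha
    · exact ⟨trivial, zero_le⟩
    · refine ⟨fun i => ⟨fun b hb => (h i).1 b ?_, (ih i (h i).2).1⟩, ?_⟩
      · exact Multiset.mem_of_le (ih i (h i).2).2 hb
      · exact Multiset.cons_le_cons _ (Finset.sum_le_sum fun i _ => (ih i (h i).2).2)

theorem HasArity.prune {f : ℕ → ℕ} {T : PlaneTree} (m : ℕ) (h : T.HasArity f) :
    (prune m T).HasArity f := by
  induction T with
  | ext => exact h
  | node a d c ih =>
    rw [PlaneTree.prune]
    split_ifs with ha
    · trivial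
    · exact ⟨h.1, fun i => ih i (h.2 i)⟩

/-- Labels below the node `m` would exceed the maximum `m`, so that node is a leaf and pruning
removes nothing else. -/
theorem exists_graft_prune {f : ℕ → ℕ} {m : ℕ} {T : PlaneTree} (hi : T.IsIncreasing)
    (hf : T.HasArity f) (hn : T.labels.Nodup) (hm : m ∈ T.labels) (hle : ∀ b ∈ T.labels, b ≤ m) :
    ∃ σ : (prune m T).Slot, graft (leaf m (f m)) (prune m T) σ = T := by
  -- The type of `σ` depends on the pruned tree; making that tree a variable lets each case
  -- substitute its value.
  suffices ∀ T', T' = prune m T → ∃ σ : T'.Slot, graft (leaf m (f m)) T' σ = T from this _ rfl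
  induction T with
  | ext => simp [labels] at hm
  | node a d c ih =>
    intro T' hT'
    by_cases ha : a = m
    · subst ha
      rw [prune, if_pos rfl] at hT'
      subst hT'
      refine ⟨(), ?_⟩
      change leaf a (f a) = _
      rw [leaf]
      obtain ⟨rfl, -⟩ := hf
      congr
      funext i
      symm
      apply eq_ext_of_labels_eq_zero
      rw [Multiset.eq_zero_iff_forall_notMem]
      intro x hx
      exact absurd ((hi i).1 x hx) (not_lt.mpr (hle x (mem_labels_node.mpr (Or.inr ⟨i, hx⟩))))
    · rw [prune, if_neg ha] at hT'
      subst hT'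
      obtain ⟨i, him⟩ := (mem_labels_node.mp hm).resolve_left (Ne.symm ha)
      rw [labels, Multiset.nodup_cons] at hn
      obtain ⟨σ, hσ⟩ := ih i (hi i).2 (hf.2 i) (nodup_of_nodup_sum hn.2 i) him
        (fun b hb => hle b (mem_labels_node.mpr (Or.inr ⟨i, hb⟩))) _ rfl
      refine ⟨⟨i, σ⟩, ?_⟩
      rw [graft, hσ]
      congr
      funext j
      by_cases hj : j = i
      · subst hj
        rw [Function.update_self]
      · rw [Function.update_of_ne hj]
        exact prune_eq_self fun hx =>
          Multiset.disjoint_left.mp (disjoint_labels_of_nodup_sum hn.2 hj) hx him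

/-! ### Counting external nodes -/

/-- Both sides count all positions, the one holding the root included: each is occupied by an
external or an internal node. -/
theorem card_slot_add {f : ℕ → ℕ} {T : PlaneTree} (h : T.HasArity f) :
    ∑ _σ : T.Slot, 1 + T.labels.card = 1 + (T.labels.map f).sum := by
  induction T with
  | ext => rw [sum_slot_ext]; simp [labels]
  | node a d c ih =>
    rw [sum_slot_node, labels, Multiset.card_cons, Multiset.card_sum, Multiset.map_cons,
      Multiset.sum_cons, ← add_assoc, ← Finset.sum_add_distrib,
      Finset.sum_congr rfl fun i _ => ih i (h.2 i), Finset.sum_add_distrib, ← h.1]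
    have : (Multiset.map f (∑ i, (c i).labels)).sum = ∑ i, (Multiset.map f (c i).labels).sum := by
      rw [← Multiset.coe_mapAddMonoidHom, map_sum, ← Multiset.coe_sumAddMonoidHom, map_sum]
    rw [this]
    simp
    omega

/-- The same double count, restricted to first positions. Since arities are positive, each internal
node owns exactly one; the root's own position counts if `b` holds. -/
theorem sum_slotWeight_add {f : ℕ → ℕ} (hf : ∀ a, 1 ≤ f a) {T : PlaneTree} (h : T.HasArity f) :
    ∀ b : Bool, ∑ σ : T.Slot, slotWeight b T σ + firstCount b T = b.toNat + T.labels.card := by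
  induction T with
  | ext => intro b; rw [sum_slot_ext]; simp [slotWeight, firstCount, labels]
  | node a d c ih =>
    intro b
    have hs : ∑ i : Fin d, (decide (i.val = 0)).toNat = 1 := by
      obtain ⟨rfl, -⟩ := h
      obtain ⟨e, he⟩ := Nat.exists_eq_add_of_le' (hf a)
      rw [he, Fin.sum_univ_succ]
      simp
    have key : ∑ i, (∑ σ : (c i).Slot, slotWeight (decide (i.val = 0)) (c i) σ +
        firstCount (decide (i.val = 0)) (c i)) = 1 + ∑ i, (c i).labels.card := by
      rw [Finset.sum_congr rfl fun i _ => ih i (h.2 i) _, Finset.sum_add_distrib, hs]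
    rw [Finset.sum_add_distrib] at key
    rw [sum_slot_node, labels, Multiset.card_cons, Multiset.card_sum, firstCount]
    simp only [slotWeight]
    omega

end PlaneTree

/-! ### Increasing trees with prescribed arities -/

namespace PlaneTree

theorem IsAryIncreasing.nodup {d u : ℕ} {X : Finset ℕ} {T : PlaneTree}
    (h : T.IsAryIncreasing d u X) : T.labels.Nodup := by
  rw [h.1]
  exact Finset.nodup _

theorem IsAryIncreasing.card_labels {d u : ℕ} {X : Finset ℕ} {T : PlaneTree}
    (h : T.IsAryIncreasing d u X) (h0 : 0 ∉ X) : T.labels.card = X.card + 1 := by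
  rw [h.1, ← Finset.card_def, Finset.card_insert_of_notMem h0]

theorem IsAryIncreasing.mem_labels {d u : ℕ} {X : Finset ℕ} {T : PlaneTree}
    (h : T.IsAryIncreasing d u X) {x : ℕ} : x ∈ T.labels ↔ x = 0 ∨ x ∈ X := by
  rw [h.1, Finset.mem_val, Finset.mem_insert]

theorem IsAryIncreasing.exists_eq_node {d u : ℕ} {X : Finset ℕ} {T : PlaneTree}
    (h : T.IsAryIncreasing d u X) : ∃ c, T = node 0 u c := by
  have h0 : 0 ∈ T.labels := h.mem_labels.mpr (Or.inl rfl)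
  obtain ⟨-, hi, ha⟩ := h
  cases T with
  | ext => simp [labels] at h0
  | node a e c =>
    rcases mem_labels_node.mp h0 with rfl | ⟨i, hx⟩
    · obtain ⟨rfl, -⟩ := ha
      exact ⟨c, rfl⟩
    · exact absurd ((hi i).1 0 hx) (Nat.not_lt_zero a)

/-- For `t = 0` the root of the subtree `T'` is itself the first child of `0`, so the two cases of
the definition agree. -/
theorem IsAryIncreasing.distinguishable_eq {d t : ℕ} {X : Finset ℕ} {T : PlaneTree}
    (h : T.IsAryIncreasing d (t + 1) X) : T.distinguishable t = T.firstChildren := by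
  obtain ⟨c, rfl⟩ := h.exists_eq_node
  rw [distinguishable]
  split_ifs with ht
  · subst ht
    simp [firstChildren, firstSubtree]
  · rfl

theorem IsAryIncreasing.ascents_add_le {d u : ℕ} {X : Finset ℕ} {T : PlaneTree}
    (h : T.IsAryIncreasing d u X) (h0 : 0 ∉ X) :
    ascents T.word + firstCount false T ≤ X.card := by
  have h1 := ascents_word_add_firstCount_le T h.2.1
  rw [h.card_labels h0] at h1
  obtain ⟨c, rfl⟩ := h.exists_eq_node
  simp only [firstCount, Bool.toNat_true, Bool.toNat_false] at h1 ⊢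
  omega

/-- Each node other than the root fills one position and opens `d + 1`, a net gain of `d` over the
initial `u`. -/
theorem IsAryIncreasing.card_slot {d u : ℕ} {X : Finset ℕ} {T : PlaneTree}
    (h : T.IsAryIncreasing (d + 1) u X) (h0 : 0 ∉ X) :
    ∑ _σ : T.Slot, 1 = u + d * X.card := by
  have h1 := card_slot_add h.2.2
  rw [h.card_labels h0, h.1, Finset.insert_val_of_notMem h0, Multiset.map_cons,
    Multiset.sum_cons, if_pos rfl] at h1
  have h2 : (Multiset.map (fun a => if a = 0 then u else d + 1) X.val).sum = X.card * (d + 1) := by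
    change ∑ a ∈ X, (if a = 0 then u else d + 1) = _
    rw [Finset.sum_congr rfl fun a ha => if_neg (ne_of_mem_of_not_mem ha h0), Finset.sum_const,
      smul_eq_mul]
  rw [h2] at h1
  linarith

theorem IsAryIncreasing.sum_slotWeight {d u : ℕ} {X : Finset ℕ} {T : PlaneTree}
    (h : T.IsAryIncreasing (d + 1) (u + 1) X) (h0 : 0 ∉ X) :
    ∑ σ : T.Slot, slotWeight false T σ + firstCount false T = X.card + 1 := by
  rw [sum_slotWeight_add (fun a => by split_ifs <;> omega) h.2.2, h.card_labels h0]
  simp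

theorem IsAryIncreasing.graft {d u m : ℕ} {X : Finset ℕ} {T : PlaneTree}
    (h : T.IsAryIncreasing d u X) (hm : m ≠ 0) (hX : ∀ x ∈ X, x < m) (σ : T.Slot) :
    (graft (leaf m d) T σ).IsAryIncreasing d u (insert m X) := by
  refine ⟨?_, ?_, ?_⟩
  · rw [labels_graft, labels_leaf, h.1, Multiset.singleton_add, Finset.insert_comm]
    refine (Finset.insert_val_of_notMem ?_).symm
    rw [Finset.mem_insert, not_or]
    exact ⟨hm, fun hx => (hX m hx).ne rfl⟩
  · refine IsIncreasing.graft (fun _ => ⟨by simp [labels], trivial⟩) ?_ h.2.1 σ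
    intro a ha b hb
    rw [labels_leaf, Multiset.mem_singleton] at hb
    subst hb
    rcases h.mem_labels.mp ha with rfl | ha
    · exact Nat.pos_of_ne_zero hm
    · exact hX a ha
  · exact HasArity.graft (X := leaf m d) ⟨(if_neg hm).symm, fun _ => trivial⟩ h.2.2 σ

theorem IsAryIncreasing.exists_graft_prune {d u m : ℕ} {X : Finset ℕ} {T : PlaneTree}
    (h : T.IsAryIncreasing d u X) (hm0 : m ≠ 0) (hm : m ∈ X) (hX : ∀ x ∈ X, x ≤ m) :
    (prune m T).IsAryIncreasing d u (X.erase m) ∧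
      ∃ σ : (prune m T).Slot, PlaneTree.graft (leaf m d) (prune m T) σ = T := by
  obtain ⟨σ, hσ⟩ := PlaneTree.exists_graft_prune h.2.1 h.2.2 h.nodup
    (h.mem_labels.mpr (Or.inr hm)) fun b hb => by
      rcases h.mem_labels.mp hb with rfl | hb
      · exact Nat.zero_le _
      · exact hX b hb
  simp only [if_neg hm0] at hσ
  refine ⟨⟨?_, (h.2.1.prune m).1, h.2.2.prune m⟩, σ, hσ⟩
  have h1 := labels_graft (leaf m d) (prune m T) σ
  rw [hσ, labels_leaf, Multiset.singleton_add, h.1] at h1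
  rw [← Finset.erase_insert_of_ne (Ne.symm hm0), Finset.erase_val, h1, Multiset.erase_cons_head]

end PlaneTree

open PlaneTree

/-! ### Forests -/

theorem IsAryIncreasingForest.exists_parts {s d n : ℕ} {u : Fin s → ℕ} {F : Fin s → PlaneTree}
    (h : IsAryIncreasingForest d u n F) :
    ∃ X : Fin s → Finset ℕ, (∀ i j, i ≠ j → Disjoint (X i) (X j)) ∧
      (∀ x, (∃ i, x ∈ X i) ↔ 1 ≤ x ∧ x ≤ n) ∧ (∀ i, 0 ∉ X i) ∧ ∑ i, (X i).card = n ∧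
      ∀ i, (F i).IsAryIncreasing d (u i) (X i) := by
  obtain ⟨X, hd, hu, hF⟩ := h
  have hx : ∀ x, (∃ i, x ∈ X i) ↔ 1 ≤ x ∧ x ≤ n := fun x => by
    rw [← Finset.mem_Icc, ← hu]
    simp
  refine ⟨X, hd, hx, fun i h0 => ?_, ?_, hF⟩
  · have := (hx 0).mp ⟨i, h0⟩
    omega
  · rw [← Finset.card_biUnion fun i _ j _ hij => hd i j hij, hu]
    simp

theorem isAryIncreasingForest_of_parts {s d n : ℕ} {u : Fin s → ℕ} {F : Fin s → PlaneTree}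
    (X : Fin s → Finset ℕ) (hd : ∀ i j, i ≠ j → Disjoint (X i) (X j))
    (hx : ∀ x, (∃ i, x ∈ X i) ↔ 1 ≤ x ∧ x ≤ n) (hF : ∀ i, (F i).IsAryIncreasing d (u i) (X i)) :
    IsAryIncreasingForest d u n F := by
  refine ⟨X, hd, ?_, hF⟩
  ext x
  rw [Finset.mem_Icc, ← hx]
  simp

/-- The number of first children in a forest. -/
def forestFirstCount {s : ℕ} (F : Fin s → PlaneTree) : ℕ := ∑ i, firstCount false (F i)

theorem IsAryIncreasingForest.card_distinguishable {s d n : ℕ} {t : Fin s → ℕ}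
    {F : Fin s → PlaneTree} (h : IsAryIncreasingForest d (fun i => t i + 1) n F) :
    (forestDistinguishable t F).card = forestFirstCount F := by
  obtain ⟨X, hd, -, h0, -, hF⟩ := h.exists_parts
  rw [forestDistinguishable, Finset.card_biUnion]
  · refine Finset.sum_congr rfl fun i _ => ?_
    rw [(hF i).distinguishable_eq, card_firstChildren (hF i).nodup]
  · intro i _ j _ hij
    rw [Function.onFun, (hF i).distinguishable_eq, (hF j).distinguishable_eq,
      Finset.disjoint_left]
    -- All roots share the label `0`, so disjointness of the parts suffices only because `0` is
    -- never a first child.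
    have key : ∀ i, ∀ x ∈ (F i).firstChildren, x ∈ X i := by
      intro i x hx
      have hl := firstSet_subset_labels (F i) false x (by simpa [firstSet] using hx)
      refine ((hF i).mem_labels.mp hl).resolve_left ?_
      rintro rfl
      obtain ⟨c, hc⟩ := (hF i).exists_eq_node
      have hi := (hF i).2.1
      rw [hc] at hx hi
      rw [firstChildren_node] at hx
      obtain ⟨j, -, hj⟩ := Finset.mem_biUnion.mp hx
      exact ((hi j).1 0 (firstSet_subset_labels _ _ 0 hj)).false
    intro x hx hy
    exact Finset.disjoint_left.mp (hd i j hij) (key i x hx) (key j x hy)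

theorem IsAryIncreasingForest.ascents_add_le {s d n : ℕ} {u : Fin s → ℕ}
    {F : Fin s → PlaneTree} (h : IsAryIncreasingForest d u n F) :
    forestAscents F + forestFirstCount F ≤ n := by
  obtain ⟨X, -, -, h0, hc, hF⟩ := h.exists_parts
  rw [forestAscents, forestFirstCount, ← Finset.sum_add_distrib, ← hc]
  exact Finset.sum_le_sum fun i _ => (hF i).ascents_add_le (h0 i)

theorem IsAryIncreasingForest.card_slot {s d n : ℕ} {u : Fin s → ℕ}
    {F : Fin s → PlaneTree} (h : IsAryIncreasingForest (d + 1) u n F) :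
    ∑ i, ∑ _σ : (F i).Slot, 1 = ∑ i, u i + d * n := by
  obtain ⟨X, -, -, h0, hc, hF⟩ := h.exists_parts
  rw [Finset.sum_congr rfl fun i _ => (hF i).card_slot (h0 i), Finset.sum_add_distrib,
    ← Finset.mul_sum, hc]

theorem IsAryIncreasingForest.sum_slotWeight {s d n : ℕ} {t : Fin s → ℕ}
    {F : Fin s → PlaneTree} (h : IsAryIncreasingForest (d + 1) (fun i => t i + 1) n F) :
    ∑ i, ∑ σ : (F i).Slot, slotWeight false (F i) σ + forestFirstCount F = n + s := by
  obtain ⟨X, -, -, h0, hc, hF⟩ := h.exists_parts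
  rw [forestFirstCount, ← Finset.sum_add_distrib,
    Finset.sum_congr rfl fun i _ => (hF i).sum_slotWeight (h0 i), Finset.sum_add_distrib, hc]
  simp

/-- Replace an external node of a forest by a leaf labelled `m`. -/
def graftForest {s : ℕ} (m d : ℕ) (F : Fin s → PlaneTree) (p : Σ i, (F i).Slot) :
    Fin s → PlaneTree :=
  Function.update F p.1 (graft (leaf m d) (F p.1) p.2)

theorem forestFirstCount_graftForest {s : ℕ} (m d : ℕ) (F : Fin s → PlaneTree)
    (p : Σ i, (F i).Slot) :
    forestFirstCount (graftForest m d F p) =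
      slotWeight false (F p.1) p.2 + forestFirstCount F :=
  sum_apply_update (fun _ => firstCount false) F p.1 _ (firstCount_graft m d _ false p.2)

theorem IsAryIncreasingForest.graftForest {s d n : ℕ} {u : Fin s → ℕ}
    {F : Fin s → PlaneTree} (h : IsAryIncreasingForest d u n F) (p : Σ i, (F i).Slot) :
    IsAryIncreasingForest d u (n + 1) (graftForest (n + 1) d F p) := by
  obtain ⟨X, hd, hx, h0, hc, hF⟩ := h.exists_parts
  obtain ⟨i, σ⟩ := p
  have hn : ∀ j, n + 1 ∉ X j := fun j hj => by
    have := (hx _).mp ⟨j, hj⟩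
    omega
  refine isAryIncreasingForest_of_parts (Function.update X i (insert (n + 1) (X i))) ?_ ?_ ?_
  · intro j k hjk
    rcases eq_or_ne j i with rfl | hj
    · rw [Function.update_self, Function.update_of_ne hjk.symm, Finset.disjoint_insert_left]
      exact ⟨hn k, hd j k hjk⟩
    · rw [Function.update_of_ne hj]
      rcases eq_or_ne k i with rfl | hk
      · rw [Function.update_self, Finset.disjoint_insert_right]
        exact ⟨hn j, hd j k hjk⟩
      · rw [Function.update_of_ne hk]
        exact hd j k hjk
  · intro x
    have key : (∃ j, x ∈ Function.update X i (insert (n + 1) (X i)) j) ↔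
        x = n + 1 ∨ ∃ j, x ∈ X j := by
      constructor
      · rintro ⟨j, hj⟩
        rcases eq_or_ne j i with rfl | hji
        · rw [Function.update_self, Finset.mem_insert] at hj
          exact hj.imp_right fun h => ⟨j, h⟩
        · rw [Function.update_of_ne hji] at hj
          exact Or.inr ⟨j, hj⟩
      · rintro (rfl | ⟨j, hj⟩)
        · exact ⟨i, by simp⟩
        · refine ⟨j, ?_⟩
          rcases eq_or_ne j i with rfl | hji
          · rw [Function.update_self]
            exact Finset.mem_insert_of_mem hj
          · rwa [Function.update_of_ne hji]
    rw [key, hx]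
    omega
  · intro j
    rw [_root_.graftForest]
    rcases eq_or_ne j i with rfl | hj
    · rw [Function.update_self, Function.update_self]
      exact (hF j).graft (Nat.succ_ne_zero n)
        (fun x hxj => Nat.lt_succ_of_le ((hx x).mp ⟨j, hxj⟩).2) σ
    · rw [Function.update_of_ne hj, Function.update_of_ne hj]
      exact hF j

theorem IsAryIncreasingForest.notMem_labels {s d n : ℕ} {u : Fin s → ℕ}
    {F : Fin s → PlaneTree} (h : IsAryIncreasingForest d u n F) (i : Fin s) :
    n + 1 ∉ (F i).labels := by
  obtain ⟨X, -, hx, -, -, hF⟩ := h.exists_parts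
  rw [(hF i).mem_labels, not_or]
  refine ⟨Nat.succ_ne_zero n, fun hi => ?_⟩
  have := (hx _).mp ⟨i, hi⟩
  omega

theorem IsAryIncreasingForest.prune_graftForest {s d n : ℕ} {u : Fin s → ℕ}
    {F : Fin s → PlaneTree} (h : IsAryIncreasingForest d u n F) (p : Σ i, (F i).Slot) :
    (fun i => prune (n + 1) (_root_.graftForest (n + 1) d F p i)) = F := by
  funext j
  rw [_root_.graftForest]
  rcases eq_or_ne j p.1 with rfl | hj
  · rw [Function.update_self]
    exact prune_graft (h.notMem_labels _) _
  · rw [Function.update_of_ne hj]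
    exact prune_eq_self (h.notMem_labels _)

theorem IsAryIncreasingForest.graftForest_injective {s d n : ℕ} {u : Fin s → ℕ}
    {F : Fin s → PlaneTree} (h : IsAryIncreasingForest d u n F) :
    Function.Injective (_root_.graftForest (n + 1) d F) := by
  have hl : n + 1 ∈ (leaf (n + 1) d).labels := by simp [labels_leaf]
  rintro ⟨i, σ⟩ ⟨j, τ⟩ hp
  simp only [_root_.graftForest] at hp
  have hij : i = j := by
    by_contra hij
    have := congrFun hp i
    rw [Function.update_self, Function.update_of_ne hij] at this
    exact graft_ne_self hl (h.notMem_labels i) σ this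
  subst hij
  have := congrFun hp i
  rw [Function.update_self, Function.update_self] at this
  rw [graft_injective hl (h.notMem_labels i) this]

theorem IsAryIncreasingForest.exists_graftForest {s d n : ℕ} {u : Fin s → ℕ}
    {F : Fin s → PlaneTree} (h : IsAryIncreasingForest d u (n + 1) F) :
    ∃ G, IsAryIncreasingForest d u n G ∧ ∃ p, _root_.graftForest (n + 1) d G p = F := by
  obtain ⟨X, hd, hx, h0, hc, hF⟩ := h.exists_parts
  obtain ⟨i, hi⟩ := (hx (n + 1)).mpr (by omega)
  have hj : ∀ j, j ≠ i → n + 1 ∉ X j := fun j hji hm =>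
    Finset.disjoint_left.mp (hd j i hji) hm hi
  obtain ⟨hP, σ, hσ⟩ := (hF i).exists_graft_prune (Nat.succ_ne_zero n) hi
    fun x hxi => ((hx x).mp ⟨i, hxi⟩).2
  have hpr : ∀ j, j ≠ i → prune (n + 1) (F j) = F j := fun j hji => prune_eq_self (by
    rw [(hF j).mem_labels, not_or]
    exact ⟨Nat.succ_ne_zero n, hj j hji⟩)
  refine ⟨fun j => prune (n + 1) (F j), isAryIncreasingForest_of_parts
    (fun j => (X j).erase (n + 1)) ?_ ?_ ?_, ⟨i, σ⟩, ?_⟩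
  · intro j k hjk
    exact (hd j k hjk).mono (Finset.erase_subset _ _) (Finset.erase_subset _ _)
  · intro x
    simp only [Finset.mem_erase, exists_and_left, hx]
    omega
  · intro j
    rcases eq_or_ne j i with rfl | hji
    · exact hP
    · simp only [hpr j hji, Finset.erase_eq_of_notMem (hj j hji)]
      exact hF j
  · funext j
    rw [_root_.graftForest]
    rcases eq_or_ne j i with rfl | hji
    · rw [Function.update_self]
      exact hσ
    · rw [Function.update_of_ne hji]
      exact hpr j hji

/-- Forests on `[n+1]` correspond to forests on `[n]` with a distinguished external node. -/
noncomputable def graftForestEquiv {s : ℕ} (d : ℕ) (u : Fin s → ℕ) (n : ℕ) :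
    (Σ F : {F : Fin s → PlaneTree // IsAryIncreasingForest d u n F}, Σ i, (F.1 i).Slot) ≃
      {F : Fin s → PlaneTree // IsAryIncreasingForest d u (n + 1) F} :=
  Equiv.ofBijective (fun q => ⟨graftForest (n + 1) d q.1.1 q.2, q.1.2.graftForest q.2⟩) <| by
    constructor
    · rintro ⟨⟨F, hF⟩, p⟩ ⟨⟨G, hG⟩, q⟩ h
      have h' := congrArg Subtype.val h
      -- Pruning `n + 1` recovers the underlying forest; the external node is then determined by
      -- injectivity for a fixed forest.
      have hFG : F = G := by
        rw [← hF.prune_graftForest p, ← hG.prune_graftForest q]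
        simp only at h'
        rw [h']
      subst hFG
      obtain rfl := hF.graftForest_injective h'
      rfl
    · rintro ⟨F, hF⟩
      obtain ⟨G, hG, p, hp⟩ := hF.exists_graftForest
      exact ⟨⟨⟨G, hG⟩, p⟩, Subtype.ext hp⟩

theorem isAryIncreasingForest_zero_iff {s d : ℕ} {u : Fin s → ℕ} {F : Fin s → PlaneTree} :
    IsAryIncreasingForest d u 0 F ↔ F = fun i => leaf 0 (u i) := by
  constructor
  · intro h
    obtain ⟨X, -, hx, -, -, hF⟩ := h.exists_parts
    funext i
    obtain ⟨c, hc⟩ := (hF i).exists_eq_node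
    have hl := (hF i).1
    have hX : X i = ∅ := by
      rw [Finset.eq_empty_iff_forall_notMem]
      intro x hxi
      have := (hx x).mp ⟨i, hxi⟩
      omega
    rw [hX, hc, labels] at hl
    rw [hc, leaf]
    congr
    funext j
    refine eq_ext_of_labels_eq_zero ?_
    have : ∑ j, (c j).labels = 0 :=
      (Multiset.cons_inj_right 0).mp hl
    exact Finset.sum_eq_zero_iff.mp this j (Finset.mem_univ j)
  · rintro rfl
    refine isAryIncreasingForest_of_parts (fun _ => ∅) (by simp) (by intro x; simp; omega) ?_
    intro i
    exact ⟨by simp [labels_leaf], fun _ => ⟨by simp [labels], trivial⟩,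
      (if_pos rfl).symm, fun _ => trivial⟩

theorem finite_isAryIncreasingForest {s : ℕ} (d : ℕ) (u : Fin s → ℕ) (n : ℕ) :
    Finite {F : Fin s → PlaneTree // IsAryIncreasingForest d u n F} := by
  induction n with
  | zero =>
    simp only [isAryIncreasingForest_zero_iff]
    infer_instance
  | succ n => exact Finite.of_equiv _ (graftForestEquiv d u n)

/-! ### The recurrence -/

/-- There are finitely many forests on `[n]`. -/
noncomputable instance instFintypeForest {s : ℕ} (d : ℕ) (u : Fin s → ℕ) (n : ℕ) :
    Fintype {F : Fin s → PlaneTree // IsAryIncreasingForest d u n F} :=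
  @Fintype.ofFinite _ (finite_isAryIncreasingForest d u n)

/-- The number of pairs of a forest on `[n]` and a set of `r` distinguishable nodes of it. -/
noncomputable def markedForestCount {s : ℕ} (d : ℕ) (u : Fin s → ℕ) (n r : ℕ) : ℕ :=
  ∑ F : {F : Fin s → PlaneTree // IsAryIncreasingForest d u n F}, (forestFirstCount F.1).choose r

theorem markedForestCount_zero_zero {s : ℕ} (d : ℕ) (u : Fin s → ℕ) :
    markedForestCount d u 0 0 = 1 := by
  have : Unique {F : Fin s → PlaneTree // IsAryIncreasingForest d u 0 F} :=
    ⟨⟨⟨_, isAryIncreasingForest_zero_iff.mpr rfl⟩⟩,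
      fun F => Subtype.ext (isAryIncreasingForest_zero_iff.mp F.2)⟩
  simp [markedForestCount]

theorem markedForestCount_of_lt {s d n r : ℕ} {u : Fin s → ℕ} (h : n < r) :
    markedForestCount d u n r = 0 := by
  refine Finset.sum_eq_zero fun F _ => Nat.choose_eq_zero_of_lt ?_
  have := F.2.ascents_add_le
  omega

theorem markedForestCount_succ {s : ℕ} (d : ℕ) (u : Fin s → ℕ) (n r : ℕ) :
    markedForestCount d u (n + 1) r =
      ∑ F : {F : Fin s → PlaneTree // IsAryIncreasingForest d u n F}, ∑ i, ∑ σ : (F.1 i).Slot,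
        (slotWeight false (F.1 i) σ + forestFirstCount F.1).choose r := by
  rw [markedForestCount, ← Fintype.sum_equiv (graftForestEquiv d u n)
    (fun q => (slotWeight false (q.1.1 q.2.1) q.2.2 + forestFirstCount q.1.1).choose r),
    Fintype.sum_sigma]
  · refine Finset.sum_congr rfl fun F _ => ?_
    rw [Fintype.sum_sigma]
  · intro q
    rw [← forestFirstCount_graftForest (n + 1) d]
    rfl

/-- Pascal's rule. The factor `1` is kept so that summing over external nodes factors out their
number as `∑ 1`. -/
theorem choose_add_succ_of_le_one {w : ℕ} (hw : w ≤ 1) (D r : ℕ) :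
    (w + D).choose (r + 1) = 1 * D.choose (r + 1) + w * D.choose r := by
  obtain rfl | rfl : w = 0 ∨ w = 1 := by omega
  · simp
  · rw [add_comm 1 D, Nat.choose_succ_succ]
    ring

theorem markedForestCount_succ_zero {s : ℕ} (d : ℕ) (u : Fin s → ℕ) (n : ℕ) :
    markedForestCount (d + 1) u (n + 1) 0 =
      (∑ i, u i + d * n) * markedForestCount (d + 1) u n 0 := by
  rw [markedForestCount_succ, markedForestCount, Finset.mul_sum]
  refine Finset.sum_congr rfl fun F _ => ?_
  simp only [Nat.choose_zero_right, F.2.card_slot, mul_one]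

/-- The negative parts of the coefficients stand on the left, avoiding truncated subtraction. -/
theorem markedForestCount_succ_succ {s : ℕ} (d : ℕ) (t : Fin s → ℕ) (n r : ℕ) :
    markedForestCount (d + 1) (fun i => t i + 1) (n + 1) (r + 1) +
        r * markedForestCount (d + 1) (fun i => t i + 1) n r +
        (r + 1) * markedForestCount (d + 1) (fun i => t i + 1) n (r + 1) =
      (n + s) * markedForestCount (d + 1) (fun i => t i + 1) n r +
        (∑ i, (t i + 1) + d * n) * markedForestCount (d + 1) (fun i => t i + 1) n (r + 1) := by
  rw [markedForestCount_succ]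
  simp only [markedForestCount, Finset.mul_sum, ← Finset.sum_add_distrib]
  refine Finset.sum_congr rfl fun F _ => ?_
  rw [← F.2.sum_slotWeight, ← F.2.card_slot]
  simp only [choose_add_succ_of_le_one (slotWeight_le_one _ _ _), Finset.sum_add_distrib,
    ← Finset.sum_mul]
  generalize forestFirstCount F.1 = D
  -- What remains is `D C(D,r) = r C(D,r) + (r+1) C(D,r+1)`.
  have h := Nat.choose_succ_right_eq D r
  rcases le_or_gt r D with hr | hr
  · obtain ⟨e, rfl⟩ := Nat.exists_eq_add_of_le hr
    rw [Nat.add_sub_cancel_left] at h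
    linear_combination h
  · rw [Nat.choose_eq_zero_of_lt hr, Nat.choose_eq_zero_of_lt (by omega : D < r + 1)]
    simp

/-! ### Identification with the Ward numbers -/

theorem wardNumber_eq_zero_of_lt (ν s t : ℕ) :
    ∀ {n k : ℕ}, n < k → wardNumber ν s t n k = 0
  | 0, _ + 1, _ => by rw [wardNumber]
  | n + 1, k + 1, h => by
      rw [wardNumber, wardNumber_eq_zero_of_lt ν s t (by omega),
        wardNumber_eq_zero_of_lt ν s t (by omega)]
      simp

theorem wardNumber_eq_markedForestCount {s : ℕ} (ν : ℕ) (t : Fin s → ℕ) (n : ℕ) :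
    ∀ k ≤ n, wardNumber ν s (∑ i, t i) n k =
      markedForestCount (ν + 2) (fun i => t i + 1) n (n - k) := by
  induction n with
  | zero =>
    intro k hk
    obtain rfl : k = 0 := by omega
    rw [wardNumber, Nat.sub_zero, markedForestCount_zero_zero]
  | succ n ih =>
    have hsum : ∑ i, (t i + 1) = ∑ i, t i + s := by simp [Finset.sum_add_distrib]
    intro k hk
    rcases k with _ | k
    -- With `r = n` the first coefficient is `n + s - n = s`, and the other term vanishes, as at
    -- most `n` nodes can be marked.
    · have h := markedForestCount_succ_succ (ν + 1) t n n
      rw [markedForestCount_of_lt (Nat.lt_succ_self n)] at h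
      rw [wardNumber, ih 0 (Nat.zero_le n), Nat.sub_zero, Nat.sub_zero]
      linarith
    · obtain ⟨r, rfl⟩ := Nat.exists_eq_add_of_le (Nat.le_of_succ_le_succ hk)
      rw [wardNumber, ih k (by omega), show k + r + 1 - (k + 1) = r by omega,
        show k + r - k = r by omega]
      rcases r with _ | r
      -- Here `n = k` and nothing is marked: the factor is the number of external nodes, `t + s +
      -- (ν+1)k`.
      · rw [wardNumber_eq_zero_of_lt ν s _ (by omega), markedForestCount_succ_zero (ν + 1), hsum]
        ring_nf
      · have h := markedForestCount_succ_succ (ν + 1) t (k + (r + 1)) r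
        rw [ih (k + 1) (by omega), show k + (r + 1) - (k + 1) = r by omega]
        rw [hsum] at h
        linarith

theorem theorem6p2 (n t ν s k : ℕ) (hν : 1 ≤ ν) (hs : 1 ≤ s) (hk : k ≤ n)
    (tt : Fin s → ℕ) (htt : ∑ i, tt i = t) :
    {p : (Fin s → PlaneTree) × Finset ℕ |
        IsAryIncreasingForest (ν + 2) (fun i => tt i + 1) n p.1 ∧
        forestAscents p.1 ≤ k ∧
        p.2 ⊆ forestDistinguishable tt p.1 ∧
        p.2.card = n - k}.encard = (wardNumber ν s t n k : ℕ∞) := by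
  subst htt
  rw [wardNumber_eq_markedForestCount ν tt n k hk, markedForestCount, Set.encard]
  have e : {p : (Fin s → PlaneTree) × Finset ℕ |
        IsAryIncreasingForest (ν + 2) (fun i => tt i + 1) n p.1 ∧
        forestAscents p.1 ≤ k ∧
        p.2 ⊆ forestDistinguishable tt p.1 ∧
        p.2.card = n - k} ≃
      Σ F : {F : Fin s → PlaneTree // IsAryIncreasingForest (ν + 2) (fun i => tt i + 1) n F},
        (forestDistinguishable tt F.1).powersetCard (n - k) :=
    { toFun := fun p => ⟨⟨p.1.1, p.2.1⟩, p.1.2, Finset.mem_powersetCard.mpr p.2.2.2⟩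
      invFun := fun q => ⟨(q.1.1, q.2.1), q.1.2, by
        have h := Finset.mem_powersetCard.mp q.2.2
        have h1 := Finset.card_le_card h.1
        have h2 := q.1.2.ascents_add_le
        rw [q.1.2.card_distinguishable] at h1
        simp only
        omega, Finset.mem_powersetCard.mp q.2.2⟩
      left_inv := fun _ => rfl
      right_inv := fun _ => rfl }
  rw [ENat.card_congr e, ENat.card_eq_coe_fintype_card, Fintype.card_sigma]
  congr 1
  refine Finset.sum_congr rfl fun F _ => ?_
  rw [Fintype.card_coe, Finset.card_powersetCard, F.2.card_distinguishable]
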